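/- All groups are abelian; a group $A$ is called a Whitehead group if $\mathrm{Ext}(A,\mathbb Z)=0$. For an ordinal (or cardinal) $\rho$, a ladder system of length $\rho$ on a set $T$ of ordinals is a family $\{\eta_\delta:\delta\in T\}$ of strictly increasing functions $\eta_\delta:\rho\to\delta$ with range cofinal in $\delta$. Assume GCH. Let $\mu$ be a singular cardinal of cofinality $\sigma$ and let $\lambda=\mu^+$. Let $S$ be a stationary subset of $\lambda$ consisting of ordinals of cofinality $\sigma$, and let $\bar\eta=\{\eta_\delta:\delta\in S\}$ be a ladder system of length $\sigma$ on $S$. If $\sigma>\aleph_0$, let $E$ be a stationary subset of $\sigma$ consisting of limit ordinals of cofinality $\omega$, and let $\bar\zeta=\{\zeta_\nu:\nu\in E\}$ be a ladder system of length $\omega$ on $E$; if $\sigma=\aleph_0$, let $E=\{0\}$. Let $F$ be the free abelian group on the symbols $y_{\delta,\nu,n}$ ($\delta\in S$, $\nu\in E$, $n\in\omega$), $z_{\delta,j}$ ($\delta\in S$, $j<\sigma$) and $x_\beta$ ($\beta<\lambda$), and let $K$ be the subgroup of $F$ generated by the elements \[ w_{\delta,\nu,n}=2y_{\delta,\nu,n+1}-y_{\delta,\nu,n}-z_{\delta,\zeta_\nu(n)}+x_{\eta_\delta(\nu+n)}\qquad(\delta\in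 S,\ \nu\in E,\ n\in\omega); \] if $\sigma=\aleph_0$, the symbols $z_{\delta,j}$ and the corresponding terms of $w_{\delta,\nu,n}$ are omitted. If $H$ is a group of cardinality $\lambda$ isomorphic to $F/K$ and $A$ is a Whitehead group of cardinality $\mu$, then $\mathrm{Ext}(H,A)\neq 0$. -/

import Mathlib

universe u

open Cardinal Ordinal Set

/-- The generalized continuum hypothesis: `2 ^ κ = κ⁺` for every infinite cardinal `κ`. -/
def GCH : Prop :=
  ∀ κ : Cardinal.{u}, ℵ₀ ≤ κ → (2 : Cardinal.{u}) ^ κ = Order.succ κ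

/-- `Ext(G, C)` for abelian groups: the group `Ext¹` in the category of `ℤ`-modules. -/
abbrev ExtGroup (G C : Type u) [AddCommGroup G] [AddCommGroup C] : Type u :=
  CategoryTheory.Abelian.Ext (ModuleCat.of ℤ G) (ModuleCat.of ℤ C) 1

/-- A Whitehead group is an abelian group `A` with `Ext(A, ℤ) = 0`. -/
def IsWhitehead (A : Type u) [AddCommGroup A] : Prop :=
  Subsingleton (ExtGroup A (ULift.{u} ℤ))

/-- A ladder system of length `ρ` on a set `T` of ordinals below `κ`: for each `δ ∈ T` a strictly
increasing function from `ρ` to `δ` whose range is cofinal in `δ`. -/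
structure LadderSystem {κ : Ordinal.{u}} (ρ : Ordinal.{u}) (T : Set (Iio κ)) where
  ladder : ∀ δ : T, Iio ρ → Iio δ.1.1
  strictMono : ∀ δ, StrictMono (ladder δ)
  isCofinal_range : ∀ δ, IsCofinal (range (ladder δ))

/-- The data from which the group is built, for an infinite cardinal `μ` of cofinality
`σ = μ.ord.cof`: a stationary set `S` of ordinals of cofinality `σ` below `μ⁺`, with a ladder system
`η` of length `σ` on `S`; and, if `σ` is uncountable, a stationary set `E` of ordinals of
cofinality `ω` below `σ`, with a ladder system `ζ` of length `ω` on `E`.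
If `σ = ℵ₀`, then `E = {0}` and there is no `ζ`. -/
structure LadderData (μ : Cardinal.{u}) where
  aleph0_le : ℵ₀ ≤ μ
  S : Set (Iio (Order.succ μ).ord)
  S_stationary : IsStationary S
  S_cof : ∀ δ ∈ S, δ.1.cof = μ.ord.cof
  η : LadderSystem μ.ord.cof.ord S
  E : Set (Iio μ.ord.cof.ord)
  E_stationary : ℵ₀ < μ.ord.cof → IsStationary E
  E_cof : ℵ₀ < μ.ord.cof → ∀ ν ∈ E, ν.1.cof = ℵ₀
  E_countable : μ.ord.cof = ℵ₀ → ∀ ν, ν ∈ E ↔ ν.1 = 0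
  ζ : ℵ₀ < μ.ord.cof → LadderSystem ω E

namespace LadderData

variable {μ : Cardinal.{u}}

/-- The free generators `y_{δ,ν,n}`, `z_{δ,j}` (only if `σ` is uncountable) and `x_β`. -/
inductive Gen (D : LadderData μ) : Type (u + 1)
  | y (δ : D.S) (ν : D.E) (n : ℕ) : Gen D
  | z (hσ : ℵ₀ < μ.ord.cof) (δ : D.S) (j : Iio μ.ord.cof.ord) : Gen D
  | x (β : Iio (Order.succ μ).ord) : Gen D

/-- The free abelian group `F` on the generators. -/
abbrev F (D : LadderData μ) : Type (u + 1) := D.Gen →₀ ℤ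

/-- A generator as an element of `F`. -/
noncomputable abbrev gen (D : LadderData μ) (g : D.Gen) : D.F := Finsupp.single g 1

theorem add_nat_lt (D : LadderData μ) (ν : Iio μ.ord.cof.ord) (n : ℕ) :
    ν.1 + (n : Ordinal.{u}) < μ.ord.cof.ord := by
  have hσ : ℵ₀ ≤ μ.ord.cof := by
    rw [aleph0_le_cof_iff, one_lt_cof_iff]
    exact isSuccLimit_ord D.aleph0_le
  have hω : ω ≤ μ.ord.cof.ord := by
    rw [← ord_aleph0]
    exact ord_le_ord.2 hσ
  exact (isPrincipal_add_ord hσ) ν.2 ((natCast_lt_omega0 n).trans_le hω)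

/-- The ordinal `η_δ(ν + n)`, as an ordinal below `μ⁺`. -/
def etaAdd (D : LadderData μ) (δ : D.S) (ν : D.E) (n : ℕ) : Iio (Order.succ μ).ord :=
  ⟨(D.η.ladder δ ⟨ν.1.1 + n, D.add_nat_lt ν.1 n⟩).1,
    mem_Iio.2 (lt_trans (mem_Iio.1 (D.η.ladder δ _).2) (mem_Iio.1 δ.1.2))⟩

/-- The ordinal `ζ_ν(n)`, as an ordinal below `σ`. -/
def zetaNat (D : LadderData μ) (hσ : ℵ₀ < μ.ord.cof) (ν : D.E) (n : ℕ) : Iio μ.ord.cof.ord :=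
  ⟨((D.ζ hσ).ladder ν ⟨n, natCast_lt_omega0 n⟩).1,
    mem_Iio.2 (lt_trans (mem_Iio.1 ((D.ζ hσ).ladder ν _).2) (mem_Iio.1 ν.1.2))⟩

open Classical in
/-- The relators `w_{δ,ν,n} = 2 y_{δ,ν,n+1} - y_{δ,ν,n} - z_{δ,ζ_ν(n)} + x_{η_δ(ν+n)}`,
where the term with `z` is omitted if `σ = ℵ₀`. -/
noncomputable def w (D : LadderData μ) (δ : D.S) (ν : D.E) (n : ℕ) : D.F :=
  (2 : ℤ) • D.gen (.y δ ν (n + 1)) - D.gen (.y δ ν n)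
    - (if hσ : ℵ₀ < μ.ord.cof then D.gen (.z hσ δ (D.zetaNat hσ ν n)) else 0)
    + D.gen (.x (D.etaAdd δ ν n))

/-- The subgroup `K` of `F` generated by the relators. -/
noncomputable def K (D : LadderData μ) : AddSubgroup D.F :=
  AddSubgroup.closure {k | ∃ (δ : D.S) (ν : D.E) (n : ℕ), k = D.w δ ν n}

/-- `H` is (isomorphic to) the group `F / K` built on the ladder systems `η` and `ζ`. -/
def IsBuilt (D : LadderData μ) (H : Type u) [AddCommGroup H] : Prop :=
  Nonempty (H ≃+ D.F ⧸ D.K)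

end LadderData

-- Cardinal arithmetic, ranks and clubs.

universe v

/-! Since `K` is free on the relators (`relMap_injective`), vanishing of Ext(H, A) makes the system
given by the relators solvable in A for all right-hand sides (`exists_solution`). Let G be the set
of functions σ → σ. Under GCH μ is a strong limit, so |G| < μ and there are at most μ^μ = λ families
of elements of A indexed by G. Fix right-hand sides for each g in G, with solutions x^g, and code
each family (x^g_β)_g by an ordinal below λ. For some δ in S, codes of β < δ stay below δ. As |δ| ≤
μ, these codes split into σ ranks of size less than μ, so a g recording the ranks along η_δ confines
each x^g at η_δ(i) to a small set. The right-hand sides for g were chosen to defeat exactly such x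
(`exists_unsolvable`), a contradiction.

That choice is local at δ. If σ is uncountable, some ν in E has all z at ζ_ν(n) in a small set, and
a sequence unsolvable modulo a small subgroup suffices (`exists_seq_unsolvable_mod`). If σ = ℵ₀, one
diagonalises against the rank of y₀ (`exists_seq_unsolvable`). Both rest on |A/2A| ≥ μ
(`le_mk_quotient`). -/

theorem GCH.isStrongLimit (hGCH : GCH.{u}) {μ : Cardinal.{u}} (hμ : μ.IsSingular) :
    μ.IsStrongLimit := by
  have hl := hμ.isSuccLimit
  refine ⟨hμ.pos.ne', fun κ hκ => ?_⟩
  rcases lt_or_ge κ ℵ₀ with h | h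
  · exact (power_lt_aleph0 (natCast_lt_aleph0 (n := 2)) h).trans_le hμ.aleph0_le
  · rw [hGCH κ h]
    exact hl.succ_lt hκ

/-- A small power of a small cardinal stays below a strong limit cardinal. -/
theorem Cardinal.IsStrongLimit.power_lt {μ κ θ : Cardinal.{u}} (hμ : μ.IsStrongLimit)
    (hκ : κ < μ) (hθ : θ < μ) : κ ^ θ < μ := by
  calc κ ^ θ ≤ (2 ^ κ) ^ θ := power_le_power_right (cantor κ).le
    _ = 2 ^ (κ * θ) := (power_mul ..).symm
    _ < μ := hμ.isStrongPrelimit (mul_lt_of_lt hμ.aleph0_le hκ hθ)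

/-- A union of fewer than `cf μ` sets of size less than `μ` has size less than `μ`. -/
theorem Cardinal.mk_iUnion_lt_of_lt_cof {ι α : Type u} {μ : Cardinal.{u}} (hμ : ℵ₀ ≤ μ)
    (hι : #ι < μ.ord.cof) {X : ι → Set α} (hX : ∀ i, #(X i) < μ) : #(⋃ i, X i) < μ :=
  (mk_iUnion_le X).trans_lt <|
    mul_lt_of_lt hμ (hι.trans_le (cof_ord_le μ)) (iSup_lt_of_lt_cof_ord hι hX)

theorem Cardinal.mk_union_lt {α : Type u} {μ : Cardinal.{u}} (hμ : ℵ₀ ≤ μ) {s t : Set α}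
    (hs : #s < μ) (ht : #t < μ) : #(s ∪ t : Set α) < μ :=
  (mk_union_le s t).trans_lt (add_lt_of_lt hμ hs ht)

/-- A type of size at most `μ` can be split into `cf μ` pieces of size less than `μ`. -/
theorem Cardinal.exists_rank {μ : Cardinal.{u}} (hμ : ℵ₀ ≤ μ) {T : Type u} (hT : #T ≤ μ) :
    ∃ r : T → Iio μ.ord.cof.ord, ∀ i, #{t | r t = i} < μ := by
  obtain ⟨s, hs, hs'⟩ := Order.exists_cof_eq μ.ord.ToType
  rw [cof_toType] at hs'
  obtain ⟨e⟩ : Nonempty (s ≃ μ.ord.cof.ord.ToType) := by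
    rw [← Cardinal.eq, hs', mk_ord_toType]
  obtain ⟨j⟩ : Nonempty (T ↪ μ.ord.ToType) := by
    rw [← Cardinal.le_def, mk_ord_toType]; exact hT
  -- Each point goes to a member of the cofinal set above it, so every fibre lies in a proper
  -- initial segment.
  choose c hc hjc using fun t => hs (j t)
  refine ⟨fun t => ToType.mk.symm (e ⟨c t, hc t⟩), fun i => ?_⟩
  obtain ⟨x, rfl⟩ : ∃ x : s, ToType.mk.symm (e x) = i :=
    ⟨e.symm (ToType.mk i), by simp⟩
  have h1 : #{t | ToType.mk.symm (e ⟨c t, hc t⟩) = ToType.mk.symm (e x)} ≤ #(Iic x.1) := by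
    refine mk_le_of_injective (f := fun t => ⟨j t.1, ?_⟩) ?_
    · have := t.2
      simp only [mem_ofPred_eq, EmbeddingLike.apply_eq_iff_eq] at this
      exact (hjc _).trans_eq (congrArg Subtype.val this)
    · intro a b h
      simpa [Subtype.ext_iff] using h
  refine h1.trans_lt ?_
  rw [← Iio_insert]
  refine mk_insert_le.trans_lt (add_lt_of_lt hμ ?_ (one_lt_aleph0.trans_le hμ))
  exact (mk_Iio_lt x.1 (by simp)).trans_eq (mk_ord_toType μ)

/-- The set of points closed under a function is club in a regular uncountable cardinal. -/
theorem isClub_setOf_closed {κ : Cardinal.{u}} (hκ : κ.IsRegular) (hκ' : ℵ₀ < κ)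
    (h : Iio κ.ord → Iio κ.ord) : IsClub {δ | ∀ β < δ, h β < δ} := by
  refine ⟨fun d hd _ _ a ha β hβ => ?_, fun a => ?_⟩
  · obtain ⟨x, hx, hβx⟩ := (lt_isLUB_iff ha).1 hβ
    exact (hd hx β hβx).trans_le (ha.1 hx)
  · let h' : Ordinal.{u} → Ordinal.{u} := fun β => if hb : β < κ.ord then (h ⟨β, hb⟩).1 else 0
    have hh' : ∀ β, h' β < κ.ord := fun β => by
      simp only [h']
      split_ifs
      · exact (h _).2
      · exact hκ.ord_pos
    -- `f γ` strictly exceeds all values of `h` below `γ`, so the limit of the iterates of `f` is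
    -- closed under `h`.
    let f : Ordinal.{u} → Ordinal.{u} := fun γ => ⨆ β : Iio γ, h' β + 1
    have hf : ∀ γ < κ.ord, f γ < κ.ord := fun γ hγ => by
      refine lift_iSup_add_one_lt_of_lt_cof ?_ fun β => hh' _
      rwa [← lift_cof, hκ.cof_ord, Cardinal.mk_Iio_ordinal, Cardinal.lift_lift,
        Cardinal.lift_lt, ← lt_ord]
    have hn : nfp f a < κ.ord := nfp_lt_ord (by rwa [hκ.cof_ord]) hf a.2
    refine ⟨⟨nfp f a, hn⟩, fun β hβ => ?_, ?_⟩
    · obtain ⟨n, hβn⟩ := lt_nfp_iff.1 (Subtype.mk_lt_mk.1 hβ : β.1 < nfp f a)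
      have h1 : h' β + 1 ≤ f (f^[n] a) :=
        Ordinal.le_iSup (fun β : Iio (f^[n] a.1) => h' β + 1) ⟨β.1, hβn⟩
      rw [← Function.iterate_succ_apply' f] at h1
      have h2 : h' β = (h β).1 := by simp [h', mem_Iio.1 β.2]
      rw [h2] at h1
      exact Subtype.mk_lt_mk.2 (((lt_add_one _).trans_le h1).trans_le (iterate_le_nfp f a (n + 1)))
    · exact Subtype.mk_le_mk.2 (le_nfp f a)

/-- A subgroup generated by fewer than `μ` elements has size less than `μ`. -/
theorem AddSubgroup.mk_closure_lt {A : Type u} [AddCommGroup A] {μ : Cardinal.{u}} (hμ : ℵ₀ < μ)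
    {s : Set A} (hs : #s < μ) : #(AddSubgroup.closure s) < μ := by
  have h : (AddSubgroup.closure s : Set A) =
      range (Finsupp.linearCombination ℤ ((↑) : s → A)) := by
    rw [← Submodule.span_int_eq_addSubgroupClosure, Submodule.coe_toAddSubgroup,
      Finsupp.span_eq_range_linearCombination, LinearMap.coe_range]
  change #((AddSubgroup.closure s : AddSubgroup A) : Set A) < μ
  rw [h]
  refine mk_range_le.trans_lt ?_
  rcases isEmpty_or_nonempty s with h0 | h0
  · rw [mk_eq_one]
    exact one_lt_aleph0.trans hμ
  · rw [mk_finsupp_lift_of_infinite']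
    simp [hs, hμ]

/-! ### Vanishing of Ext as lifting and extension of homomorphisms. -/

open CategoryTheory in
/-- If `Ext(A, L) = 0`, then maps from `A` lift along surjections with kernel `L`. -/
theorem exists_lift_of_subsingleton_ext {A L M N : Type u} [AddCommGroup A] [AddCommGroup L]
    [AddCommGroup M] [AddCommGroup N] (h : Subsingleton (ExtGroup A L)) (f : L →ₗ[ℤ] M)
    (g : M →ₗ[ℤ] N) (hf : Function.Injective f) (hfg : Function.Exact f g)
    (hg : Function.Surjective g) (φ : A →ₗ[ℤ] N) : ∃ ψ : A →ₗ[ℤ] M, g ∘ₗ ψ = φ := by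
  let S := ModuleCat.shortComplexOfCompEqZero f g hfg.linearMap_comp_eq_zero
  have hS : S.ShortExact := ModuleCat.shortComplex_shortExact S hfg hf hg
  obtain ⟨x, hx⟩ := Abelian.Ext.covariant_sequence_exact₃ (X := ModuleCat.of ℤ A) hS
    (Abelian.Ext.mk₀ (ModuleCat.ofHom φ)) (zero_add 1) (h.elim _ _)
  obtain ⟨ψ, rfl⟩ := (Abelian.Ext.mk₀_bijective _ _).2 x
  rw [Abelian.Ext.mk₀_comp_mk₀] at hx
  have := (Abelian.Ext.mk₀_bijective _ _).1 hx
  exact ⟨ψ.hom, by simpa [S] using congrArg ModuleCat.Hom.hom this⟩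

open CategoryTheory in
/-- If `Ext(H, A) = 0`, then maps to `A` extend along injections with cokernel `H`. -/
theorem exists_extend_of_subsingleton_ext {H A L M : Type u} [AddCommGroup A] [AddCommGroup L]
    [AddCommGroup M] [AddCommGroup H] (h : Subsingleton (ExtGroup H A)) (f : L →ₗ[ℤ] M)
    (g : M →ₗ[ℤ] H) (hf : Function.Injective f) (hfg : Function.Exact f g)
    (hg : Function.Surjective g) (φ : L →ₗ[ℤ] A) : ∃ ψ : M →ₗ[ℤ] A, ψ ∘ₗ f = φ := by
  let S := ModuleCat.shortComplexOfCompEqZero f g hfg.linearMap_comp_eq_zero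
  have hS : S.ShortExact := ModuleCat.shortComplex_shortExact S hfg hf hg
  obtain ⟨x, hx⟩ := Abelian.Ext.contravariant_sequence_exact₁ (Y := ModuleCat.of ℤ A) hS
    (Abelian.Ext.mk₀ (ModuleCat.ofHom φ)) (add_zero 1) (h.elim _ _)
  obtain ⟨ψ, rfl⟩ := (Abelian.Ext.mk₀_bijective _ _).2 x
  rw [Abelian.Ext.mk₀_comp_mk₀] at hx
  have := (Abelian.Ext.mk₀_bijective _ _).1 hx
  exact ⟨ψ.hom, by simpa [S] using congrArg ModuleCat.Hom.hom this⟩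

/-- `exists_extend_of_subsingleton_ext` for modules that are small, but live in another universe. -/
theorem exists_extend_of_subsingleton_ext_of_small {H A : Type u} {L M : Type v} [AddCommGroup A]
    [AddCommGroup L] [AddCommGroup M] [AddCommGroup H] [Small.{u} L] [Small.{u} M]
    (h : Subsingleton (ExtGroup H A)) (f : L →ₗ[ℤ] M)
    (g : M →ₗ[ℤ] H) (hf : Function.Injective f) (hfg : Function.Exact f g)
    (hg : Function.Surjective g) (φ : L →ₗ[ℤ] A) : ∃ ψ : M →ₗ[ℤ] A, ψ ∘ₗ f = φ := by
  let eL := Shrink.linearEquiv.{u} ℤ L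
  let eM := Shrink.linearEquiv.{u} ℤ M
  obtain ⟨ψ, hψ⟩ := exists_extend_of_subsingleton_ext h
    (eM.symm.toLinearMap ∘ₗ f ∘ₗ eL.toLinearMap) (g ∘ₗ eM.toLinearMap)
    (eM.symm.injective.comp (hf.comp eL.injective))
    (fun x => by
      obtain ⟨m, rfl⟩ := eM.symm.surjective x
      simp only [LinearMap.comp_apply, LinearEquiv.coe_coe, LinearEquiv.apply_symm_apply, hfg m,
        mem_range, EmbeddingLike.apply_eq_iff_eq]
      exact ⟨fun ⟨y, hy⟩ => ⟨eL.symm y, by simpa using hy⟩, fun ⟨y, hy⟩ => ⟨eL y, hy⟩⟩)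
    (hg.comp eM.surjective) (φ ∘ₗ eL.toLinearMap)
  refine ⟨ψ ∘ₗ eM.symm.toLinearMap, LinearMap.ext fun l => ?_⟩
  simpa using LinearMap.congr_fun hψ (eL.symm l)

namespace IsWhitehead

variable {A : Type u} [AddCommGroup A]

/-- Homomorphisms from a Whitehead group lift along a surjection with kernel `ℤ`. -/
theorem exists_lift (hA : IsWhitehead A) {M N : Type} [AddCommGroup M] [AddCommGroup N]
    (f : ℤ →+ M) (g : M →+ N) (hf : Function.Injective f) (hfg : Function.Exact f g)
    (hg : Function.Surjective g) (φ : A →+ N) : ∃ ψ : A →+ M, ∀ a, g (ψ a) = φ a := by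
  let f' : ULift.{u} ℤ →ₗ[ℤ] ULift.{u} M :=
    (AddEquiv.ulift.symm.toAddMonoidHom.comp (f.comp AddEquiv.ulift.toAddMonoidHom)).toIntLinearMap
  let g' : ULift.{u} M →ₗ[ℤ] ULift.{u} N :=
    (AddEquiv.ulift.symm.toAddMonoidHom.comp (g.comp AddEquiv.ulift.toAddMonoidHom)).toIntLinearMap
  obtain ⟨ψ, hψ⟩ := exists_lift_of_subsingleton_ext hA f' g'
    (ULift.up_injective.comp (hf.comp ULift.down_injective))
    (fun x => by
      obtain ⟨m⟩ := x
      have := hfg m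
      constructor
      · intro hx
        obtain ⟨y, hy⟩ := this.1 (ULift.up_injective hx)
        exact ⟨⟨y⟩, ULift.ext _ _ hy⟩
      · rintro ⟨⟨y⟩, hy⟩
        exact ULift.ext _ _ (this.2 ⟨y, congrArg ULift.down hy⟩))
    (ULift.up_surjective.comp (hg.comp ULift.down_surjective))
    (AddEquiv.ulift.symm.toAddMonoidHom.comp φ).toIntLinearMap
  refine ⟨(AddEquiv.ulift : ULift.{u} M ≃+ M).toAddMonoidHom.comp ψ.toAddMonoidHom, fun a => ?_⟩
  exact congrArg ULift.down (LinearMap.congr_fun hψ a)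

/-- Characters of a Whitehead group lift to the rationals. -/
theorem exists_lift_character (hA : IsWhitehead A) (χ : A →+ AddCircle (1 : ℚ)) :
    ∃ ψ : A →+ ℚ, ∀ a, (ψ a : AddCircle (1 : ℚ)) = χ a := by
  refine hA.exists_lift (Int.castAddHom ℚ) (QuotientAddGroup.mk' _) Int.cast_injective
    (fun q => ?_) (QuotientAddGroup.mk'_surjective _) χ
  rw [← AddMonoidHom.mem_ker, QuotientAddGroup.ker_mk', AddSubgroup.mem_zmultiples_iff]
  simp

/-- Homomorphisms from a Whitehead group to `ℤ / 2` lift to `ℤ`. -/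
theorem exists_lift_zmod_two (hA : IsWhitehead A) (χ : A →+ ZMod 2) :
    ∃ ψ : A →+ ℤ, ∀ a, (ψ a : ZMod 2) = χ a := by
  refine hA.exists_lift (zmultiplesHom ℤ 2) (Int.castAddHom (ZMod 2)) ?_ (fun q => ?_)
    ZMod.intCast_surjective χ
  · intro a b h
    simpa using h
  · simp only [Int.coe_castAddHom, zmultiplesHom_apply, mem_range]
    rw [ZMod.intCast_zmod_eq_zero_iff_dvd]
    simp [dvd_def, mul_comm, eq_comm]

end IsWhitehead

/-! ### Torsion, divisibility and the size of A/2A. -/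

theorem Int.eq_zero_of_forall_pow_dvd {c : ℕ} (hc : 1 < c) {m : ℤ}
    (h : ∀ k : ℕ, (c : ℤ) ^ k ∣ m) : m = 0 := by
  refine Int.eq_zero_of_abs_lt_dvd (h m.natAbs) ?_
  rw [Int.abs_eq_natAbs]
  exact_mod_cast Nat.lt_pow_self hc

/-- The subgroup `2A`. -/
abbrev twoMul (A : Type u) [AddCommGroup A] : AddSubgroup A := (zsmulAddGroupHom (α := A) 2).range

namespace IsWhitehead

variable {A : Type u} [AddCommGroup A]

/-- Characters separate points, and each factors through ℚ, where torsion dies. -/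
theorem eq_zero_of_zsmul_eq_zero (hA : IsWhitehead A) {n : ℤ} (hn : n ≠ 0) {a : A}
    (h : n • a = 0) : a = 0 := by
  refine CharacterModule.eq_zero_of_character_apply fun χ => ?_
  obtain ⟨ψ, hψ⟩ := hA.exists_lift_character χ
  have h0 : n • ψ a = 0 := by rw [← map_zsmul, h, map_zero]
  have h1 : ψ a = 0 := by simpa [hn] using h0
  have := hψ a
  rw [h1] at this
  exact this.symm

/-- A Whitehead group has no nonzero element that is divisible by all powers of `4`. -/
theorem eq_zero_of_forall_four_pow (hA : IsWhitehead A) {a : A}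
    (h : ∀ n : ℕ, ∃ b : A, (4 ^ n : ℤ) • b = a) : a = 0 := by
  by_contra ha
  choose b hb using h
  have hstep : ∀ n, (4 : ℤ) • b (n + 1) = b n := fun n => by
    refine sub_eq_zero.1 (hA.eq_zero_of_zsmul_eq_zero (n := 4 ^ n) (by positivity) ?_)
    rw [smul_sub, smul_smul, ← pow_succ, hb, hb, _root_.sub_self]
  have hpow : ∀ n k, (4 ^ k : ℤ) • b (n + k) = b n := fun n k => by
    induction k with
    | zero => simp
    | succ k ih => rw [pow_succ, mul_smul, ← add_assoc, hstep, ih]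
  let B : AddSubgroup A :=
    { carrier := {x | ∃ (m : ℤ) (n : ℕ), x = m • b n}
      zero_mem' := ⟨0, 0, by simp⟩
      add_mem' := by
        rintro _ _ ⟨m, n, rfl⟩ ⟨m', n', rfl⟩
        refine ⟨m * 4 ^ n' + m' * 4 ^ n, n + n', ?_⟩
        rw [add_smul, mul_smul, mul_smul, hpow, add_comm n n', hpow]
      neg_mem' := by
        rintro _ ⟨m, n, rfl⟩
        exact ⟨-m, n, by simp⟩ }
  have hbB : ∀ n, b n ∈ B := fun n => ⟨1, n, by simp⟩
  -- As 3 does not divide 4 ^ n, `b 0` is not in 3B; hence some character of B of order 3 is nonzero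
  -- at `b 0`.
  have hnot : (⟨b 0, hbB 0⟩ : B) ∉ (zsmulAddGroupHom (α := B) 3).range := by
    rintro ⟨⟨_, m, n, rfl⟩, hx⟩
    have hx' : (3 : ℤ) • m • b n = b 0 := congrArg Subtype.val hx
    have h2 := hpow 0 n
    rw [zero_add] at h2
    rw [← h2, smul_smul, ← sub_eq_zero, ← sub_smul] at hx'
    have hbn : b n ≠ 0 := by
      intro h0
      apply ha
      rw [← hb n, h0, smul_zero]
    have h3 : 3 * m - 4 ^ n = 0 := by
      by_contra hne
      exact hbn (hA.eq_zero_of_zsmul_eq_zero hne hx')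
    have h4 : (3 : ℤ) ∣ 4 ^ n := ⟨m, by linarith⟩
    have h5 := Int.prime_three.dvd_of_dvd_pow h4
    norm_num at h5
  obtain ⟨c, hc⟩ := CharacterModule.exists_character_apply_ne_zero_of_ne_zero
    (A := B ⧸ (zsmulAddGroupHom (α := B) 3).range)
    (a := QuotientAddGroup.mk ⟨b 0, hbB 0⟩) (by
      rwa [Ne, QuotientAddGroup.eq_zero_iff])
  let χ₀ : CharacterModule B := (c : _ →+ AddCircle (1 : ℚ)).comp (QuotientAddGroup.mk' _)
  have hχ₀ : ∀ x : B, (3 : ℤ) • χ₀ x = 0 := fun x => by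
    have : (QuotientAddGroup.mk' (zsmulAddGroupHom (α := B) 3).range) ((3 : ℤ) • x) = 0 :=
      (QuotientAddGroup.eq_zero_iff _).2 ⟨x, rfl⟩
    rw [← map_zsmul]
    change c _ = 0
    rw [this, map_zero]
  obtain ⟨χ, hχ⟩ := CharacterModule.dual_surjective_of_injective (R := ℤ)
    B.subtype.toIntLinearMap Subtype.val_injective χ₀
  have hχ' : ∀ x : B, χ x.1 = χ₀ x := fun x => by rw [← hχ]; rfl
  obtain ⟨ψ, hψ'⟩ := hA.exists_lift_character χ
  have hψ : ∀ x : B, ((ψ x.1 : ℚ) : AddCircle (1 : ℚ)) = χ₀ x := fun x =>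
    (hψ' x.1).trans (hχ' x)
  -- All 3ψ(b n) are integers, so 3ψ(b 0) is an integer divisible by every power of 4, hence zero.
  have hint : ∀ n, ∃ m : ℤ, 3 * ψ (b n) = m := fun n => by
    have h1 : ((3 * ψ (b n) : ℚ) : AddCircle (1 : ℚ)) = 0 := by
      have h2 : (3 * ψ (b n) : ℚ) = (3 : ℤ) • ψ (b n) := by simp
      rw [h2, AddCircle.coe_zsmul, hψ ⟨b n, hbB n⟩, hχ₀]
    rw [AddCircle.coe_eq_zero_iff] at h1
    obtain ⟨m, hm⟩ := h1
    exact ⟨m, by rw [← hm]; simp⟩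
  choose m hm using hint
  have hm0 : m 0 = 0 := by
    refine Int.eq_zero_of_forall_pow_dvd (c := 4) (by norm_num) fun k => ⟨m k, ?_⟩
    have h1 := congrArg ψ (hpow 0 k)
    rw [map_zsmul, zero_add, zsmul_eq_mul] at h1
    have h2 : (m 0 : ℚ) = 4 ^ k * m k := by
      rw [← hm, ← hm, ← h1]; push_cast; ring
    exact_mod_cast h2
  have h0 : ψ (b 0) = 0 := by
    have := hm 0
    rw [hm0] at this
    simpa using this
  apply hc
  have h1 := hψ ⟨b 0, hbB 0⟩
  rw [h0] at h1
  exact h1.symm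

/-- If a Whitehead group has size at least a strong limit cardinal `μ > ℵ₀`, so has `A / 2A`. -/
theorem le_mk_quotient (hA : IsWhitehead A) {μ : Cardinal.{u}} (hμ : μ.IsStrongLimit)
    (hunc : ℵ₀ < μ) (hAcard : μ ≤ #A) : μ ≤ #(A ⧸ twoMul A) := by
  by_contra! hlt
  have hd : ∀ a : A, ∃ d : A,
      a = (QuotientAddGroup.mk a : A ⧸ twoMul A).out + (2 : ℤ) • d := fun a => by
    have h1 : (QuotientAddGroup.mk (QuotientAddGroup.mk a : A ⧸ twoMul A).out : A ⧸ twoMul A)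
      = QuotientAddGroup.mk a := Quotient.out_eq' _
    obtain ⟨d, hd⟩ := QuotientAddGroup.eq.1 h1
    exact ⟨d, by change (2 : ℤ) • d = _ at hd; rw [hd]; abel⟩
  choose d hd using hd
  -- The residues modulo 2A are the binary digits of `a`; they determine it because no nonzero
  -- element is infinitely 2-divisible.
  have hinj : Function.Injective fun (a : A) (n : ℕ) =>
      (QuotientAddGroup.mk (d^[n] a) : A ⧸ twoMul A) := fun a a' h => by
    have h1 : ∀ n, a - a' = (2 ^ n : ℤ) • (d^[n] a - d^[n] a') := fun n => by
      induction n with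
      | zero => simp
      | succ n ih =>
        have h2 := congrFun h n
        have h3 := hd (d^[n] a)
        have h4 := hd (d^[n] a')
        simp only at h2
        rw [h2] at h3
        have h5 : d^[n] a - d^[n] a' = (2 : ℤ) • (d (d^[n] a) - d (d^[n] a')) := by
          have h6 := congrArg₂ (· - ·) h3 h4
          simpa only [add_sub_add_left_eq_sub, ← smul_sub] using h6
        rw [ih, h5, smul_smul, ← pow_succ, Function.iterate_succ_apply',
          Function.iterate_succ_apply']
    refine sub_eq_zero.1 (hA.eq_zero_of_forall_four_pow fun n =>
      ⟨d^[2 * n] a - d^[2 * n] a', ?_⟩)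
    rw [h1 (2 * n), pow_mul]; norm_num
  have h2 : #A ≤ #(A ⧸ twoMul A) ^ ℵ₀ := by
    simpa using mk_le_of_injective hinj
  exact (hAcard.trans h2).not_gt (hμ.power_lt hlt hunc)

/-! ### Unsolvable sequences of equations. -/

/-- If every sequence of equations `2 y (n + 1) - y n = a n` can be solved modulo the kernel of a
homomorphism `ψ` to `ℤ`, then `ψ` is zero. -/
theorem _root_.AddMonoidHom.eq_zero_of_solvable (ψ : A →+ ℤ)
    (h : ∀ a : ℕ → A, ∃ y : ℕ → A, ∀ n, 2 * ψ (y (n + 1)) - ψ (y n) = ψ (a n)) : ψ = 0 := by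
  have h3 : ∀ a, ∃ b, ψ a = 3 * ψ b := fun a => by
    -- The 2-adic solution is y₀ = -∑ 4^k a = a/3 under ψ, so the image of ψ is 3-divisible.
    obtain ⟨y, hy⟩ := h fun n => if Even n then a else 0
    refine ⟨y 0, ?_⟩
    have hstep : ∀ k, 3 * ψ (y (2 * k)) - ψ a = 4 * (3 * ψ (y (2 * (k + 1))) - ψ a) := fun k => by
      have h1 := hy (2 * k)
      have h2 := hy (2 * k + 1)
      rw [if_pos (by simp)] at h1
      rw [if_neg (by simp), map_zero] at h2
      rw [show 2 * (k + 1) = 2 * k + 1 + 1 by ring]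
      linarith
    have hpow : ∀ k, 3 * ψ (y 0) - ψ a = 4 ^ k * (3 * ψ (y (2 * k)) - ψ a) := fun k => by
      induction k with
      | zero => simp
      | succ k ih => rw [ih, hstep k]; ring
    have := Int.eq_zero_of_forall_pow_dvd (c := 4) (by norm_num) fun k => ⟨_, hpow k⟩
    linarith
  choose b hb using h3
  ext a
  refine Int.eq_zero_of_forall_pow_dvd (c := 3) (by norm_num) fun k => ⟨ψ (b^[k] a), ?_⟩
  induction k with
  | zero => simp
  | succ k ih => rw [ih, hb, Function.iterate_succ_apply', pow_succ]; push_cast; ring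

/-- Homomorphisms to `ℤ / 2` separate a subgroup that contains `2A` from its complement. -/
theorem _root_.AddSubgroup.exists_zmod_two_apply_ne_zero {Y : AddSubgroup A}
    (hY : ∀ a : A, (2 : ℕ) • a ∈ Y) {a : A} (ha : a ∉ Y) :
    ∃ χ : A →+ ZMod 2, (∀ y ∈ Y, χ y = 0) ∧ χ a ≠ 0 := by
  let : Module (ZMod 2) (A ⧸ Y) := QuotientAddGroup.zmodModule hY
  have h0 : (QuotientAddGroup.mk a : A ⧸ Y) ≠ 0 := by rwa [Ne, QuotientAddGroup.eq_zero_iff]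
  rw [Ne, ← Module.forall_dual_apply_eq_zero_iff (ZMod 2)] at h0
  push Not at h0
  obtain ⟨f, hf⟩ := h0
  refine ⟨f.toAddMonoidHom.comp (QuotientAddGroup.mk' Y), fun y hy => ?_, hf⟩
  have : QuotientAddGroup.mk' Y y = 0 := (QuotientAddGroup.eq_zero_iff y).2 hy
  rw [AddMonoidHom.comp_apply, this, map_zero]

/-- For a Whitehead group of size `μ` (a strong limit) and a smaller subgroup `X`, the quotient
`A / X` is not complete in the `2`-adic topology. -/
theorem exists_seq_unsolvable_mod (hA : IsWhitehead A) {μ : Cardinal.{u}} (hμ : μ.IsStrongLimit)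
    (hunc : ℵ₀ < μ) (hAcard : μ ≤ #A) (X : AddSubgroup A) (hX : #X < μ) :
    ∃ a : ℕ → A, ¬ ∃ y x : ℕ → A, (∀ n, x n ∈ X) ∧
      ∀ n, (2 : ℤ) • y (n + 1) - y n + x n = a n := by
  by_contra! H
  have hzero : ∀ ψ : A →+ ℤ, (∀ x ∈ X, ψ x = 0) → ψ = 0 := fun ψ hψ => by
    refine ψ.eq_zero_of_solvable fun a => ?_
    obtain ⟨y, x, hx, h⟩ := H a
    refine ⟨y, fun n => ?_⟩
    rw [← h n, map_add, map_sub, map_zsmul, hψ _ (hx n)]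
    simp
  let P := {χ : A →+ ZMod 2 // ∀ x ∈ X, χ x = 0}
  choose L hL using hA.exists_lift_zmod_two
  have hP : #P < μ := by
    -- By `hzero`, an integral lift is determined by its values on `X`.
    have hinj : Function.Injective fun (χ : P) (x : X) => L χ.1 x.1 := fun χ χ' h => by
      have h1 : L χ.1 - L χ'.1 = 0 := hzero _ fun x hx => by
        have := congrFun h ⟨x, hx⟩
        simpa [sub_eq_zero] using this
      ext a
      rw [← hL, ← hL, sub_eq_zero.1 h1]
    refine (mk_le_of_injective hinj).trans_lt ?_
    have : #(X → ℤ) = ℵ₀ ^ #X := by simp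
    rw [this]
    exact hμ.power_lt hunc hX
  let Y := X ⊔ twoMul A
  have hV : #(A ⧸ Y) < μ := by
    have hinj : Function.Injective fun (v : A ⧸ Y) (χ : P) => χ.1 v.out := fun v v' h => by
      by_contra hne
      have h1 : v.out - v'.out ∉ Y := fun hmem => hne <| by
        rw [← Quotient.out_eq' v, ← Quotient.out_eq' v']
        refine (QuotientAddGroup.eq.2 ?_).symm
        rwa [neg_add_eq_sub]
      obtain ⟨χ, hχ, hne⟩ := AddSubgroup.exists_zmod_two_apply_ne_zero
        (fun a => (le_sup_right : twoMul A ≤ Y) ⟨a, (two_zsmul a).trans (two_nsmul a).symm⟩) h1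
      have := congrFun h ⟨χ, fun x hx => hχ x ((le_sup_left : X ≤ Y) hx)⟩
      exact hne (by simpa [sub_eq_zero] using this)
    refine (mk_le_of_injective hinj).trans_lt ?_
    have : #(P → ZMod 2) = 2 ^ #P := by simp
    rw [this]
    exact hμ.isStrongPrelimit hP
  have hle : #(A ⧸ twoMul A) ≤ #((A ⧸ Y) × X) := by
    refine mk_le_of_surjective (f := fun p => QuotientAddGroup.mk (p.1.out + p.2.1)) fun q => ?_
    obtain ⟨a, rfl⟩ := QuotientAddGroup.mk_surjective q
    have h1 : (QuotientAddGroup.mk (QuotientAddGroup.mk a : A ⧸ Y).out : A ⧸ Y)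
      = QuotientAddGroup.mk a := Quotient.out_eq' _
    obtain ⟨x, hx, t, ht, hxt⟩ := AddSubgroup.mem_sup.1 (QuotientAddGroup.eq.1 h1)
    refine ⟨⟨QuotientAddGroup.mk a, ⟨x, hx⟩⟩, QuotientAddGroup.eq.2 ?_⟩
    convert ht using 1
    rw [eq_sub_of_add_eq' hxt]
    abel
  rw [mk_prod, Cardinal.lift_id, Cardinal.lift_id] at hle
  exact ((hA.le_mk_quotient hμ hunc hAcard).trans hle).not_gt (mul_lt_of_lt hμ.aleph0_le hV hX)

/-- An element `a` of a large Whitehead group can be chosen so that `2 ^ n • a` is not congruent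
modulo `2 ^ (n + 1)` to an element of a given small subgroup. -/
theorem exists_forall_add_ne (hA : IsWhitehead A) {μ : Cardinal.{u}} (hμ : μ.IsStrongLimit)
    (hunc : ℵ₀ < μ) (hAcard : μ ≤ #A) (n : ℕ) (G : AddSubgroup A) (hG : #G < μ) :
    ∃ a : A, ∀ s ∈ G, ∀ b : A, s + (2 ^ n : ℤ) • a ≠ (2 ^ (n + 1) : ℤ) • b := by
  by_contra! H
  choose s hs b hb using H
  -- If `s` agrees on two representatives, cancelling 2 ^ n shows that they are congruent modulo 2A.
  have hinj : Function.Injective fun q : A ⧸ twoMul A => (⟨s q.out, hs _⟩ : G) :=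
    fun q q' h => by
      have h1 : s q.out = s q'.out := congrArg Subtype.val h
      rw [← Quotient.out_eq' q, ← Quotient.out_eq' q']
      refine (QuotientAddGroup.eq.2 ⟨b q'.out - b q.out, ?_⟩)
      refine sub_eq_zero.1 (hA.eq_zero_of_zsmul_eq_zero (n := 2 ^ n) (by positivity) ?_)
      change (2 ^ n : ℤ) • ((2 : ℤ) • (b q'.out - b q.out) - (-q.out + q'.out)) = 0
      have h2 := hb q.out
      have h3 := hb q'.out
      rw [pow_succ, mul_smul] at h2 h3
      rw [smul_sub, smul_sub, smul_sub, ← h2, ← h3, h1, smul_add, smul_neg]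
      abel
  exact ((hA.le_mk_quotient hμ hunc hAcard).trans (mk_le_of_injective hinj)).not_gt hG

/-- A sequence of elements, each chosen with regard to a finite set that contains all its
predecessors. -/
theorem _root_.exists_seq_of_forall_finset {α : Type*} (P : ℕ → Finset α → α → Prop)
    (h : ∀ n T, ∃ a, P n T a) :
    ∃ (a : ℕ → α) (T : ℕ → Finset α), (∀ n, ∀ k < n, a k ∈ T n) ∧ ∀ n, P n (T n) (a n) := by
  classical
  choose f hf using h
  let T : ℕ → Finset α := fun n => n.rec ∅ fun k S => insert (f k S) S
  refine ⟨fun n => f n (T n), T, fun n => ?_, fun n => hf n (T n)⟩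
  induction n with
  | zero => exact fun k hk => absurd hk (Nat.not_lt_zero k)
  | succ n ih =>
    intro k hk
    change _ ∈ insert (f n (T n)) (T n)
    rcases Nat.lt_succ_iff_lt_or_eq.1 hk with h | rfl
    · exact Finset.mem_insert_of_mem (ih k h)
    · exact Finset.mem_insert_self _ _

theorem _root_.Cardinal.mk_biUnion_lt_nat {α : Type u} {μ : Cardinal.{u}} (hμ : ℵ₀ ≤ μ)
    {X : ℕ → Set α} (hX : ∀ n, #(X n) < μ) (n : ℕ) : #(⋃ k < n, X k : Set α) < μ := by
  induction n with
  | zero => simpa using aleph0_pos.trans_le hμ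
  | succ m ih =>
    rw [biUnion_lt_succ]
    exact mk_union_lt hμ ih (hX m)

/-- In a Whitehead group of size `μ` (a strong limit of cofinality `ω`), a sequence of equations
can be made unsolvable for `x n` restricted to given sets `X n` of size less than `μ`. -/
theorem exists_seq_unsolvable (hA : IsWhitehead A) {μ : Cardinal.{u}} (hμ : μ.IsStrongLimit)
    (hunc : ℵ₀ < μ) (hAcard : μ ≤ #A) (r : A → ℕ) (hr : ∀ n, #{a | r a = n} < μ)
    (X : ℕ → Set A) (hX : ∀ n, #(X n) < μ) :
    ∃ a : ℕ → A, ¬ ∃ y x : ℕ → A, (∀ n, x n ∈ X n) ∧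
      ∀ n, (2 : ℤ) • y (n + 1) - y n + x n = a n := by
  let Y : ℕ → Set A := fun n => {a | r a = n} ∪ ⋃ k < n + 1, X k
  have hYr : ∀ b, b ∈ Y (r b) := fun b => .inl rfl
  have hYX : ∀ n, ∀ k ≤ n, X k ⊆ Y n := fun n k hk b hb =>
    .inr (mem_biUnion (Nat.lt_succ_of_le hk) hb)
  have hY : ∀ n, #(Y n) < μ := fun n =>
    mk_union_lt hμ.aleph0_le (hr n) (mk_biUnion_lt_nat hμ.aleph0_le hX _)
  clear_value Y
  obtain ⟨a, T, haT, ha⟩ := exists_seq_of_forall_finset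
    (fun n (T : Finset A) a => ∀ s ∈ AddSubgroup.closure (Y n ∪ T), ∀ b : A,
      s + (2 ^ n : ℤ) • a ≠ (2 ^ (n + 1) : ℤ) • b)
    fun n T => hA.exists_forall_add_ne hμ hunc hAcard n _ <| AddSubgroup.mk_closure_lt hunc <|
      mk_union_lt hμ.aleph0_le (hY n) ((lt_aleph0_of_finite T).trans hunc)
  refine ⟨a, ?_⟩
  rintro ⟨y, x, hx, h⟩
  have hexp : ∀ N n, n ≤ N → ∃ s ∈ AddSubgroup.closure (Y N ∪ T N),
      y 0 - s = (2 ^ n : ℤ) • y n := fun N n => by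
    induction n with
    | zero => exact fun _ => ⟨0, zero_mem _, by simp⟩
    | succ n ih =>
      intro hn
      obtain ⟨s, hs, hy⟩ := ih (by omega)
      refine ⟨s + (2 ^ n : ℤ) • (x n - a n), add_mem hs (zsmul_mem (sub_mem ?_ ?_) _), ?_⟩
      · exact AddSubgroup.subset_closure (.inl (hYX N n (by omega) (hx n)))
      · exact AddSubgroup.subset_closure (.inr (haT N n (by omega)))
      · rw [← _root_.sub_sub, hy, ← smul_sub, pow_succ, mul_smul, ← h n]
        congr 1
        abel
  -- The rank of `y 0` names the stage whose subgroup already contains `y 0`.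
  obtain ⟨N, hN⟩ : ∃ N, r (y 0) = N := ⟨_, rfl⟩
  obtain ⟨s, hs, hy⟩ := hexp N N le_rfl
  refine ha N (y 0 - s - (2 ^ N : ℤ) • x N) (sub_mem (sub_mem ?_ hs) (zsmul_mem ?_ _))
    (y (N + 1)) ?_
  · exact AddSubgroup.subset_closure (.inl (hN ▸ hYr (y 0)))
  · exact AddSubgroup.subset_closure (.inl (hYX N N le_rfl (hx N)))
  · rw [hy, ← smul_sub, ← smul_add, pow_succ, mul_smul, ← h N]
    congr 1
    abel

end IsWhitehead

/-! ### The relators and their systems of equations. -/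

namespace LadderData

variable {μ : Cardinal.{u}} (D : LadderData μ)

theorem aleph0_le_cof (D : LadderData μ) : ℵ₀ ≤ μ.ord.cof := by
  rw [aleph0_le_cof_iff, one_lt_cof_iff]
  exact isSuccLimit_ord D.aleph0_le

instance small_gen : Small.{u} D.Gen := by
  let f : D.Gen → (D.S × D.E × ℕ) ⊕ (D.S × Iio μ.ord.cof.ord) ⊕ Iio (Order.succ μ).ord
    | .y δ ν n => .inl (δ, ν, n)
    | .z _ δ j => .inr (.inl (δ, j))
    | .x β => .inr (.inr β)
  refine small_of_injective (f := f) ?_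
  rintro (⟨δ, ν, n⟩ | ⟨h, δ, j⟩ | β) (⟨δ', ν', n'⟩ | ⟨h', δ', j'⟩ | β') heq <;> simp_all [f]

theorem small_finsupp_int (α : Type v) [Small.{u} α] : Small.{u} (α →₀ ℤ) :=
  small_of_injective (f := fun c : α →₀ ℤ => (c : α → ℤ)) DFunLike.coe_injective

/-- The homomorphism from the free group on the index set of the relators onto `K`. -/
noncomputable def relMap : (D.S × D.E × ℕ →₀ ℤ) →ₗ[ℤ] D.F :=
  Finsupp.linearCombination ℤ fun p => D.w p.1 p.2.1 p.2.2

theorem coe_range_relMap : range D.relMap = (D.K : Set D.F) := by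
  have h : {k | ∃ (δ : D.S) (ν : D.E) (n : ℕ), k = D.w δ ν n} =
      range fun p : D.S × D.E × ℕ => D.w p.1 p.2.1 p.2.2 := by
    ext k
    simp [eq_comm]
  rw [K, h, ← Submodule.span_int_eq_addSubgroupClosure, Submodule.coe_toAddSubgroup,
    ← Finsupp.range_linearCombination, LinearMap.coe_range, relMap]

theorem w_apply_y (δ δ' : D.S) (ν ν' : D.E) (n m : ℕ) :
    D.w δ' ν' m (.y δ ν n) =
      2 * Finsupp.single (δ', ν', m + 1) (1 : ℤ) (δ, ν, n) -
        Finsupp.single (δ', ν', m) (1 : ℤ) (δ, ν, n) := by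
  classical
  unfold w
  split_ifs <;> simp [Finsupp.single_apply]

theorem relMap_apply_y_zero (c : D.S × D.E × ℕ →₀ ℤ) (δ : D.S) (ν : D.E) :
    D.relMap c (.y δ ν 0) = -c (δ, ν, 0) := by
  induction c using Finsupp.induction_linear with
  | zero => simp
  | add f g hf hg => rw [map_add, Finsupp.add_apply, hf, hg, Finsupp.add_apply]; ring
  | single p k =>
    obtain ⟨δ', ν', m⟩ := p
    classical
    simp [relMap, w_apply_y, Finsupp.single_apply]

theorem relMap_apply_y_succ (c : D.S × D.E × ℕ →₀ ℤ) (δ : D.S) (ν : D.E) (n : ℕ) :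
    D.relMap c (.y δ ν (n + 1)) = 2 * c (δ, ν, n) - c (δ, ν, n + 1) := by
  induction c using Finsupp.induction_linear with
  | zero => simp
  | add f g hf hg => rw [map_add, Finsupp.add_apply, hf, hg, Finsupp.add_apply,
      Finsupp.add_apply]; ring
  | single p k =>
    obtain ⟨δ', ν', m⟩ := p
    classical
    simp only [relMap, Finsupp.linearCombination_single, Finsupp.smul_apply, w_apply_y,
      Finsupp.single_apply, Prod.mk.injEq, add_left_inj]
    split_ifs <;> simp <;> ring

/-- The y-coefficients of a combination are triangular in n, so they recover its coefficients one by
one. -/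
theorem relMap_injective : Function.Injective D.relMap := by
  rw [injective_iff_map_eq_zero]
  intro c hc
  ext ⟨δ, ν, n⟩
  induction n with
  | zero =>
    have := D.relMap_apply_y_zero c δ ν
    rw [hc] at this
    simpa using this.symm
  | succ n ih =>
    have := D.relMap_apply_y_succ c δ ν n
    rw [hc, ih] at this
    simpa using this.symm

open Classical in
/-- If `Ext(H, A) = 0`, then all systems of equations given by the relators are solvable in `A`. -/
theorem exists_solution {H A : Type u} [AddCommGroup H] [AddCommGroup A] (hH : D.IsBuilt H)
    (h : Subsingleton (ExtGroup H A)) (a : D.S → D.E → ℕ → A) :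
    ∃ (x : Iio (Order.succ μ).ord → A) (y : D.S → D.E → ℕ → A)
      (z : D.S → Iio μ.ord.cof.ord → A), ∀ δ ν n,
        (2 : ℤ) • y δ ν (n + 1) - y δ ν n
          - (if hσ : ℵ₀ < μ.ord.cof then z δ (D.zetaNat hσ ν n) else 0)
          + x (D.etaAdd δ ν n) = a δ ν n := by
  obtain ⟨e⟩ := hH
  have : Small.{u} D.F := small_finsupp_int _
  have : Small.{u} (D.S × D.E × ℕ →₀ ℤ) := small_finsupp_int _
  let p : D.F →+ H := e.symm.toAddMonoidHom.comp (QuotientAddGroup.mk' D.K)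
  have hexact : Function.Exact D.relMap p.toIntLinearMap := fun k => by
    rw [D.coe_range_relMap]
    change e.symm (QuotientAddGroup.mk k) = 0 ↔ _
    rw [map_eq_zero_iff _ e.symm.injective, QuotientAddGroup.eq_zero_iff]
    rfl
  obtain ⟨ψ, hψ⟩ := exists_extend_of_subsingleton_ext_of_small h D.relMap p.toIntLinearMap
    D.relMap_injective hexact (e.symm.surjective.comp (QuotientAddGroup.mk'_surjective _))
    (Finsupp.linearCombination ℤ fun q => a q.1 q.2.1 q.2.2)
  refine ⟨fun β => ψ (D.gen (.x β)), fun δ ν n => ψ (D.gen (.y δ ν n)),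
    fun δ j => if hσ : ℵ₀ < μ.ord.cof then ψ (D.gen (.z hσ δ j)) else 0, fun δ ν n => ?_⟩
  have h1 := LinearMap.congr_fun hψ (Finsupp.single (δ, ν, n) 1)
  simp only [relMap, LinearMap.comp_apply, Finsupp.linearCombination_single, one_smul] at h1
  rw [← h1, w, map_add, map_sub, map_sub, map_zsmul]
  split_ifs <;> simp

open Classical in
/-- For fixed `δ`, the system of equations can be made unsolvable as long as the values of `x` are
restricted to given sets of size less than `μ`. -/
theorem exists_unsolvable {A : Type u} [AddCommGroup A] (hA : IsWhitehead A)
    (hμ : μ.IsStrongLimit) (hunc : ℵ₀ < μ) (hAcard : #A = μ) (X : Iio μ.ord.cof.ord → Set A)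
    (hX : ∀ i, #(X i) < μ) :
    ∃ a : D.E → ℕ → A, ∀ (x z : Iio μ.ord.cof.ord → A) (y : D.E → ℕ → A), (∀ i, x i ∈ X i) →
      ¬ ∀ (ν : D.E) (n : ℕ), (2 : ℤ) • y ν (n + 1) - y ν n
        - (if hσ : ℵ₀ < μ.ord.cof then z (D.zetaNat hσ ν n) else 0)
        + x ⟨ν.1.1 + n, D.add_nat_lt ν.1 n⟩ = a ν n := by
  obtain ⟨r, hr⟩ := exists_rank D.aleph0_le hAcard.le
  rcases D.aleph0_le_cof.lt_or_eq with hσ | hσ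
  · have hsmall : ∀ ν : D.E, #(AddSubgroup.closure ({b | r b < ν.1} ∪
        ⋃ n : ℕ, X ⟨ν.1.1 + n, D.add_nat_lt ν.1 n⟩)) < μ := fun ν => by
      refine AddSubgroup.mk_closure_lt hunc (mk_union_lt hμ.aleph0_le ?_ ?_)
      · have h1 : {b | r b < ν.1} ⊆ ⋃ t : ν.1.1.ToType,
            {b | r b = ⟨t.toOrd.1, lt_trans (mem_Iio.1 t.toOrd.2) (mem_Iio.1 ν.1.2)⟩} := fun b hb =>
          mem_iUnion.2 ⟨ToType.mk ⟨(r b).1, hb⟩, by simp⟩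
        refine (mk_le_mk_of_subset h1).trans_lt
          (mk_iUnion_lt_of_lt_cof hμ.aleph0_le ?_ fun t => hr _)
        rw [mk_toType, ← lt_ord]
        exact ν.1.2
      · rw [← Equiv.ulift.{u}.surjective.iUnion_comp]
        exact mk_iUnion_lt_of_lt_cof hμ.aleph0_le (by simpa using hσ) fun t => hX _
    choose a ha using fun ν => hA.exists_seq_unsolvable_mod hμ hunc hAcard.ge _ (hsmall ν)
    refine ⟨a, fun x z y hx h => ?_⟩
    have hreg : μ.ord.cof.IsRegular := isRegular_cof (isSuccLimit_ord D.aleph0_le)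
    -- For ν closed under j ↦ r (z j), every z at ζ_ν(n) < ν has rank below ν, hence lies in the
    -- small subgroup.
    obtain ⟨ν, hνE, hν⟩ := D.E_stationary hσ (isClub_setOf_closed hreg hσ fun j => r (z j))
    refine ha ⟨ν, hνE⟩ ⟨y ⟨ν, hνE⟩, fun n => x ⟨ν.1 + n, D.add_nat_lt ν n⟩ -
      z (D.zetaNat hσ ⟨ν, hνE⟩ n), fun n => sub_mem ?_ ?_, fun n => ?_⟩
    · exact AddSubgroup.subset_closure (.inr (mem_iUnion.2 ⟨n, hx _⟩))
    · exact AddSubgroup.subset_closure (.inl (hν _ ((D.ζ hσ).ladder ⟨ν, hνE⟩ _).2))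
    · rw [← h ⟨ν, hνE⟩ n, dif_pos hσ]
      exact ((sub_add_eq_add_sub _ _ _).trans (add_sub_assoc _ _ _)).symm
  · have h0 : (0 : Ordinal.{u}) < μ.ord.cof.ord := by
      rw [← hσ, ord_aleph0]; exact omega0_pos
    let ν : D.E := ⟨⟨0, h0⟩, (D.E_countable hσ.symm _).2 rfl⟩
    have hω : ∀ i : Iio μ.ord.cof.ord, ∃ n : ℕ, i.1 = n := fun i => by
      have hi : μ.ord.cof.ord = ω := by rw [← hσ, ord_aleph0]
      exact lt_omega0.1 ((mem_Iio.1 i.2).trans_eq hi)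
    choose k hk using hω
    obtain ⟨a, ha⟩ := hA.exists_seq_unsolvable hμ hunc hAcard.ge (fun b => k (r b))
      (fun n => by
        refine (mk_le_mk_of_subset (t := {b | r b = ⟨0 + n, D.add_nat_lt ⟨0, h0⟩ n⟩})
          fun b hb => ?_).trans_lt (hr _)
        rw [mem_ofPred_eq] at hb ⊢
        exact Subtype.ext (by rw [hk, hb]; exact (_root_.zero_add _).symm))
      (fun n => X ⟨ν.1.1 + n, D.add_nat_lt ν.1 n⟩) (fun n => hX _)
    refine ⟨fun _ => a, fun x z y hx h => ha ⟨y ν, _, fun n => hx _, fun n => ?_⟩⟩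
    have := h ν n
    rwa [dif_neg hσ.not_lt, _root_.sub_zero] at this

end LadderData

/-! ### The diagonal argument. -/

theorem mainTheorem6 (hGCH : GCH.{u}) (μ : Cardinal.{u}) (hμ : μ.IsSingular) (D : LadderData μ)
    (H : Type u) [AddCommGroup H] (hHcard : #H = Order.succ μ) (hH : D.IsBuilt H)
    (A : Type u) [AddCommGroup A] (hAcard : #A = μ) (hA : IsWhitehead A) :
    Nontrivial (ExtGroup H A) := by
  classical
  rw [← not_subsingleton_iff_nontrivial]
  intro hsub
  have hlim := hGCH.isStrongLimit hμ
  have hω : ℵ₀ < μ := D.aleph0_le_cof.trans_lt hμ.cof_ord_lt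
  let G := Iio μ.ord.cof.ord → Iio μ.ord.cof.ord
  obtain ⟨c⟩ : Nonempty ((G → A) ↪ Iio (Order.succ μ).ord) := by
    have hG : #G ≤ Cardinal.lift.{u + 1} μ := by
      have h1 : #G = Cardinal.lift.{u + 1} (μ.ord.cof ^ μ.ord.cof) := by
        simp [G, Cardinal.mk_Iio_ordinal]
      rw [h1, Cardinal.lift_le]
      exact (hlim.power_lt hμ.cof_ord_lt hμ.cof_ord_lt).le
    rw [← Cardinal.le_def, Cardinal.mk_Iio_ordinal, card_ord, ← hGCH μ D.aleph0_le,
      ← power_self_eq D.aleph0_le]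
    simp only [mk_pi, prod_const, hAcard, Cardinal.lift_power]
    refine power_le_power_left (by simpa using hμ.pos.ne') ?_
    rwa [Cardinal.lift_id'.{u, u + 1}]
  have hr : ∀ δ : D.S, ∃ r : δ.1.1.ToType → Iio μ.ord.cof.ord, ∀ i, #{t | r t = i} < μ :=
    fun δ => exists_rank D.aleph0_le (by
      rw [mk_toType, ← Order.lt_succ_iff, ← lt_ord]
      exact δ.1.2)
  choose r hr using hr
  -- Reads an ordinal below δ as the code of a family indexed by `G`.
  let dec : ∀ δ : D.S, δ.1.1.ToType → G → A := fun δ t =>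
    Function.invFun c ⟨t.toOrd.1, lt_trans (mem_Iio.1 t.toOrd.2) (mem_Iio.1 δ.1.2)⟩
  choose a ha using fun (g : G) (δ : D.S) => D.exists_unsolvable hA hlim hω hAcard
    (fun i => (fun t => dec δ t g) '' {t | r δ t = g i}) (fun i => mk_image_le.trans_lt (hr δ _))
  choose x y z hxyz using fun g => D.exists_solution hH hsub (a g)
  let h : Iio (Order.succ μ).ord → Iio (Order.succ μ).ord := fun β => c fun g => x g β
  obtain ⟨δ, hδS, hδ⟩ := D.S_stationary (isClub_setOf_closed (isRegular_succ D.aleph0_le)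
    (Order.lt_succ_of_le D.aleph0_le) h)
  let η : Iio μ.ord.cof.ord → Iio (Order.succ μ).ord := fun i =>
    ⟨(D.η.ladder ⟨δ, hδS⟩ i).1, lt_trans (mem_Iio.1 (D.η.ladder ⟨δ, hδS⟩ i).2) (mem_Iio.1 δ.2)⟩
  have hη : ∀ i, h (η i) < δ := fun i => hδ _ (D.η.ladder ⟨δ, hδS⟩ i).2
  -- One code covers the solutions for all members of `G`, so the ranks defining `g` also constrain
  -- the solution for `g` itself.
  let g : G := fun i => r ⟨δ, hδS⟩ (ToType.mk ⟨(h (η i)).1, hη i⟩)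
  refine ha g ⟨δ, hδS⟩ (fun i => x g (η i)) (z g ⟨δ, hδS⟩) (y g ⟨δ, hδS⟩) (fun i => ?_)
    (hxyz g ⟨δ, hδS⟩)
  refine ⟨ToType.mk ⟨(h (η i)).1, hη i⟩, rfl, ?_⟩
  have h1 : dec ⟨δ, hδS⟩ (ToType.mk ⟨(h (η i)).1, hη i⟩) = fun g => x g (η i) := by
    simp only [dec, ToType.toOrd, OrderIso.symm_apply_apply]
    exact Function.leftInverse_invFun c.injective _
  exact congrFun h1 g
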